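/- Let $K$ be a compact Hausdorff space, let $\mathbb{K}$ be $\mathbb{R}$ or $\mathbb{C}$, and let $A(K)$ be a uniform algebra on $K$, that is, a subalgebra of $C(K,\mathbb{K})$ that is closed in the supremum norm, contains the constants and separates the points of $K$. Let $\Gamma$ be the Shilov boundary of $A(K)$, that is, the smallest closed set $S\subset K$ such that every $g\in A(K)$ satisfies $|g(t)|=\|g\|_\infty$ for some $t\in S$. Let $f\in A(K)$ with $\|f\|_\infty=1$. For a Banach space $X$ with closed unit ball $B_X$, a slice of $B_X$ is a set $\{x\in B_X:\operatorname{Re}x^*(x)>\sup_{y\in B_X}\operatorname{Re}x^*(y)-\varepsilon\}$ with $x^*\in X^*$, $\|x^*\|=1$ and $\varepsilon>0$; a convex combination of slices of $B_X$ is a set $\sum_{i=1}^n\lambda_iS_i=\{\sum_{i=1}^n\lambda_ix_i: x_i\in S_i\}$ with $n\ge 1$, $\lambda_i>0$, $\sum_{i=1}^n\lambda_i=1$ and slices $S_1,\dots,S_n$ of $B_X$. A point $x\in X$ with $\|x\|=1$ is called a Daugavet (respectively super-Daugavet, ccs-Daugavet) point if $\sup_{y\in D}\|x-y\|=2$ for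 every slice (respectively nonempty relatively weakly open subset, convex combination of slices) $D$ of $B_X$; it is called a $\Delta$ (respectively super-$\Delta$, ccs-$\Delta$) point if $\sup_{y\in D}\|x-y\|=2$ for every such $D$ that contains $x$. Then the following statements are equivalent, where the Banach space in (2)--(7) is $A(K)$: 1. There is a limit point $t_0$ of $\Gamma$ such that $\|f\|_\infty=|f(t_0)|$. 2. $f$ is a ccs-Daugavet point. 3. $f$ is a ccs-$\Delta$ point. 4. $f$ is a super-Daugavet point. 5. $f$ is a super-$\Delta$ point. 6. $f$ is a Daugavet point. 7. $f$ is a $\Delta$ point. -/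

import Mathlib

open Set Filter Topology

section Diametral

variable (𝕜 : Type*) [RCLike 𝕜] {E : Type*} [NormedAddCommGroup E] [NormedSpace 𝕜 E]

/-- The slice of a (bounded) set `A` given by a functional `φ` and a number `ε`:
`S(A, φ, ε) = {x ∈ A : Re φ(x) > sup_{y ∈ A} Re φ(y) - ε}`. -/
def slice (A : Set E) (φ : StrongDual 𝕜 E) (ε : ℝ) : Set E :=
  {x | x ∈ A ∧ sSup ((fun y => RCLike.re (φ y)) '' A) - ε < RCLike.re (φ x)}

/-- `S` is a slice of the closed unit ball: `S = S(B_E, φ, ε)` with `‖φ‖ = 1` and `ε > 0`. -/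
def IsBallSlice (S : Set E) : Prop :=
  ∃ (φ : StrongDual 𝕜 E) (ε : ℝ), ‖φ‖ = 1 ∧ 0 < ε ∧ S = slice 𝕜 (Metric.closedBall 0 1) φ ε

/-- `C` is a convex combination of slices of the closed unit ball: `C = ∑ i, c i • S i`, with
finitely many weights `c i > 0` of sum `1` and slices `S i` of the closed unit ball. -/
def IsBallCCS (C : Set E) : Prop :=
  ∃ (n : ℕ) (c : Fin n → ℝ) (S : Fin n → Set E),
    (∀ i, 0 < c i) ∧ ∑ i, c i = 1 ∧ (∀ i, IsBallSlice 𝕜 (S i)) ∧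
    C = {x | ∃ y : Fin n → E, (∀ i, y i ∈ S i) ∧ x = ∑ i, ((c i : ℝ) : 𝕜) • y i}

/-- `W` is a relatively weakly open subset of the closed unit ball. -/
def IsBallWeaklyOpen (W : Set E) : Prop :=
  ∃ V : Set (WeakSpace 𝕜 E), IsOpen V ∧ W = Metric.closedBall 0 1 ∩ toWeakSpace 𝕜 E ⁻¹' V

/-- `sup_{y ∈ S} ‖x - y‖ = 2`. -/
def HasSupDistTwo (x : E) (S : Set E) : Prop :=
  IsLUB ((fun y => ‖x - y‖) '' S) 2

def IsCCSDaugavetPoint (x : E) : Prop :=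
  ‖x‖ = 1 ∧ ∀ C : Set E, IsBallCCS 𝕜 C → HasSupDistTwo x C

def IsSuperDaugavetPoint (x : E) : Prop :=
  ‖x‖ = 1 ∧ ∀ W : Set E, IsBallWeaklyOpen 𝕜 W → W.Nonempty → HasSupDistTwo x W

def IsDaugavetPoint (x : E) : Prop :=
  ‖x‖ = 1 ∧ ∀ S : Set E, IsBallSlice 𝕜 S → HasSupDistTwo x S

def IsCCSDeltaPoint (x : E) : Prop :=
  ‖x‖ = 1 ∧ ∀ C : Set E, IsBallCCS 𝕜 C → x ∈ C → HasSupDistTwo x C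

def IsSuperDeltaPoint (x : E) : Prop :=
  ‖x‖ = 1 ∧ ∀ W : Set E, IsBallWeaklyOpen 𝕜 W → x ∈ W → HasSupDistTwo x W

def IsDeltaPoint (x : E) : Prop :=
  ‖x‖ = 1 ∧ ∀ S : Set E, IsBallSlice 𝕜 S → x ∈ S → HasSupDistTwo x S

end Diametral

section UniformAlgebra

variable {𝕜 : Type*} [RCLike 𝕜] {K : Type*} [TopologicalSpace K] [CompactSpace K]

/-- A uniform algebra on `K`: a subalgebra of `C(K, 𝕜)` (so it contains the constants) that is
closed in the supremum norm and separates the points of `K`. -/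
structure IsUniformAlgebra (A : Subalgebra 𝕜 C(K, 𝕜)) : Prop where
  isClosed : IsClosed (A : Set C(K, 𝕜))
  separatesPoints : A.SeparatesPoints

/-- `S` is a boundary for `A`: every `f ∈ A` attains its norm at a point of `S`. -/
def IsBoundary (A : Subalgebra 𝕜 C(K, 𝕜)) (S : Set K) : Prop :=
  ∀ f ∈ A, ∃ t ∈ S, ‖f t‖ = ‖f‖

/-- The Shilov boundary of `A`, the smallest closed boundary for `A`, as the intersection of
all closed boundaries. -/
def shilovBoundary (A : Subalgebra 𝕜 C(K, 𝕜)) : Set K :=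
  ⋂₀ {S | IsClosed S ∧ IsBoundary A S}

/-- Whenever a smallest closed boundary exists, it is `shilovBoundary A`. -/
theorem shilovBoundary_eq_of_isLeast {A : Subalgebra 𝕜 C(K, 𝕜)} {Γ : Set K}
    (h : IsLeast {S | IsClosed S ∧ IsBoundary A S} Γ) : shilovBoundary A = Γ :=
  Subset.antisymm (sInter_subset_of_mem h.1) (subset_sInter fun _ hS => h.2 hS)

end UniformAlgebra

/-! Slices are both weakly open and convex combinations of slices, so each of (2)-(7) implies (7)
formally. The content is (1) ⇒ (2), (4) and (7) ⇒ (1).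

From (1), choose many points of `Γ` near `t₀` with disjoint neighbourhoods, and for each of them `g
∈ A` almost peaking in its neighbourhood with `‖g‖ + ‖1 - g‖ ≤ 1 + η` pointwise. Then `x (1 - g) - f
t₀ g`, divided by `1 + η`, stays in the unit ball and is close to `-f t₀` at a point `s`. The bumps
are almost disjoint, so a functional can be large on few of them: some bump changes every given `x`
by a weakly small amount, all at the same `s` (`exists_weak_perturbation`). The common `s` makes
convex combinations work as well, with distance to `f` near `|2 f s|`.

If (1) fails, then `|f| = 1` at only finitely many points of `Γ`, and `|f| ≤ c < 1` on the rest of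
`Γ`. A slice given by averaged evaluations at those points contains `f` and keeps `|f - y| ≤ √2`
there, so `‖f - y‖ ≤ max (√2) (1 + c) < 2`. This uses that `Γ` is itself a boundary
(`isBoundary_shilovBoundary`). -/

/-! ### Polynomials squeezing the unit disc towards `[0, 1]` -/

/-- A thin circular sector around `[0, 1]` lies in a thin ellipse with foci `0` and `1`. -/
theorem norm_add_norm_one_sub_le_of_sector {r θ b : ℝ} (hr : 0 ≤ r) (hrb : r ≤ b) (hb : 1 ≤ b) :
    ‖(r : ℂ) * Complex.exp (Complex.I * θ)‖ + ‖1 - (r : ℂ) * Complex.exp (Complex.I * θ)‖ ≤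
      2 * b - 1 + b * |θ| := by
  have h1 : ‖(r : ℂ) * Complex.exp (Complex.I * θ)‖ = r := by
    rw [norm_mul, mul_comm Complex.I, Complex.norm_exp_ofReal_mul_I, Complex.norm_real,
      Real.norm_eq_abs, abs_of_nonneg hr, mul_one]
  have h2 : ‖1 - (r : ℂ) * Complex.exp (Complex.I * θ)‖ ≤ |1 - r| + r * |θ| := by
    have : 1 - (r : ℂ) * Complex.exp (Complex.I * θ) =
        ((1 - r : ℝ) : ℂ) - r * (Complex.exp (Complex.I * θ) - 1) := by push_cast; ring
    rw [this]
    refine (norm_sub_le _ _).trans ?_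
    rw [norm_mul, Complex.norm_real, Complex.norm_real, Real.norm_eq_abs, Real.norm_eq_abs,
      abs_of_nonneg hr]
    gcongr
    simpa using Real.norm_exp_I_mul_ofReal_sub_one_le (x := θ)
  have h3 : r * |θ| ≤ b * |θ| := by gcongr
  rw [h1]
  rcases abs_cases (1 - r) with h | h <;> linarith

/-- Since `1 + u` lies in the right half-plane, its power lies in a sector of half-angle `a π / 2`
and radius `2 ^ a`, which is thin for small `a`. -/
theorem norm_cpow_add_norm_one_sub_cpow_le {a : ℝ} (ha : 0 < a) {u : ℂ} (hu : ‖u‖ < 1) :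
    ‖(1 + u) ^ (a : ℂ)‖ + ‖1 - (1 + u) ^ (a : ℂ)‖ ≤
      2 * 2 ^ a - 1 + 2 ^ a * (a * (Real.pi / 2)) := by
  have hre : 0 < (1 + u).re := by
    have := (Complex.abs_re_le_norm u).trans_lt hu
    simp only [Complex.add_re, Complex.one_re]
    linarith [(abs_lt.1 this).1]
  have h0 : 1 + u ≠ 0 := fun h => by simp [h] at hre
  have harg : |(1 + u).arg| ≤ Real.pi / 2 := Complex.abs_arg_le_pi_div_two_iff.2 hre.le
  have hn : ‖1 + u‖ ≤ 2 := (norm_add_le _ _).trans (by rw [norm_one]; linarith)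
  have key : (1 + u) ^ (a : ℂ) =
      ((‖1 + u‖ ^ a : ℝ) : ℂ) * Complex.exp (Complex.I * ((a * (1 + u).arg : ℝ) : ℂ)) := by
    rw [Complex.cpow_def_of_ne_zero h0, Complex.log, Real.rpow_def_of_pos (norm_pos_iff.2 h0),
      Complex.ofReal_exp, ← Complex.exp_add]
    congr 1
    push_cast
    ring
  rw [key]
  refine (norm_add_norm_one_sub_le_of_sector (b := 2 ^ a) (by positivity)
    (Real.rpow_le_rpow (norm_nonneg _) hn ha.le)
    (Real.one_le_rpow (by norm_num) ha.le)).trans ?_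
  rw [abs_mul, abs_of_pos ha]
  gcongr

-- The model is `1 - (1 - r z) ^ a` with `a` small and `r` close to `1`; truncating its binomial
-- series gives a polynomial, with real coefficients so that it also serves `𝕜 = ℝ`.
open Polynomial in
theorem exists_polynomial_complex {η : ℝ} (hη : 0 < η) :
    ∃ P : ℝ[X], P.eval 0 = 0 ∧ |P.eval 1 - 1| < η ∧
      ∀ z : ℂ, ‖z‖ ≤ 1 → ‖aeval z P‖ + ‖1 - aeval z P‖ ≤ 1 + η := by
  -- At `a = 0` the left side equals `1`.
  obtain ⟨a, ha, hab⟩ : ∃ a : ℝ, 0 < a ∧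
      2 * 2 ^ a - 1 + 2 ^ a * (a * (Real.pi / 2)) < 1 + η / 3 := by
    have hc : Continuous fun a : ℝ => 2 * (2 : ℝ) ^ a - 1 + 2 ^ a * (a * (Real.pi / 2)) := by
      have : Continuous fun a : ℝ => (2 : ℝ) ^ a :=
        continuous_const.rpow continuous_id fun _ => Or.inl (by norm_num)
      fun_prop
    have h : ∀ᶠ a in 𝓝 (0 : ℝ),
        2 * (2 : ℝ) ^ a - 1 + 2 ^ a * (a * (Real.pi / 2)) < 1 + η / 3 :=
      hc.continuousAt.eventually_lt_const (by norm_num; linarith)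
    obtain ⟨a, h1, h2⟩ := ((h.filter_mono nhdsWithin_le_nhds).and
      (self_mem_nhdsWithin (s := Ioi (0 : ℝ)))).exists
    exact ⟨a, h2, h1⟩
  obtain ⟨r, hr0, hr1, hra⟩ : ∃ r : ℝ, 0 < r ∧ r < 1 ∧ (1 - r) ^ a < η / 3 := by
    have hc : ContinuousAt (fun r : ℝ => (1 - r) ^ a) 1 :=
      (continuousAt_const.sub continuousAt_id).rpow_const (Or.inr ha.le)
    have h : ∀ᶠ r in 𝓝 (1 : ℝ), (1 - r) ^ a < η / 3 :=
      hc.tendsto.eventually_lt_const (by simp only [sub_self, Real.zero_rpow ha.ne']; linarith)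
    obtain ⟨r, ⟨h1, h2⟩, h3⟩ := (((h.filter_mono nhdsWithin_le_nhds).and
      (Ioo_mem_nhdsLT (show (0 : ℝ) < 1 by norm_num)))).exists.imp
      (fun r h => (⟨⟨h.1, h.2.1⟩, h.2.2⟩ : ((1 - r) ^ a < η / 3 ∧ 0 < r) ∧ r < 1))
    exact ⟨r, h2, h3, h1⟩
  -- With `r < ρ < 1`, all points `-r z` lie in a ball on which the series converges uniformly.
  obtain ⟨ρ, hρ⟩ : ∃ ρ : NNReal, (ρ : ℝ) = (r + 1) / 2 :=
    ⟨((r + 1) / 2).toNNReal, Real.coe_toNNReal _ (by linarith)⟩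
  have hF := (Complex.one_add_cpow_hasFPowerSeriesOnBall_zero (a := (a : ℂ))).tendstoUniformlyOn
    (r' := ρ) (by rw [ENNReal.coe_lt_one_iff, ← NNReal.coe_lt_coe, hρ, NNReal.coe_one]; linarith)
  -- `n ≥ 1` keeps the constant term `1` in `Q`, so that `1 - Q` vanishes at `0`.
  obtain ⟨n, hn, hn1⟩ := ((Metric.tendstoUniformlyOn_iff.1 hF (η / 6) (by linarith)).and
    (eventually_ge_atTop 1)).exists
  let Q : ℝ[X] := ∑ k ∈ Finset.range n, C (Ring.choose a k * (-r) ^ k) * X ^ k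
  have hQ : ∀ z : ℂ, aeval z Q = (binomialSeries ℂ (a : ℂ)).partialSum n (-r * z) := by
    intro z
    simp only [Q, map_sum, map_mul, aeval_C, map_pow, aeval_X, FormalMultilinearSeries.partialSum,
      binomialSeries_apply, List.ofFn_const, List.prod_replicate, smul_eq_mul]
    refine Finset.sum_congr rfl fun k _ => ?_
    rw [mul_pow, ← Complex.ofReal_choose]
    simp
    ring
  have hapx : ∀ z : ℂ, ‖z‖ ≤ 1 → ‖(1 + -r * z) ^ (a : ℂ) - aeval z Q‖ < η / 6 := by
    intro z hz
    have := hn (-r * z) (by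
      rw [mem_ball_zero_iff, hρ, norm_mul, norm_neg, Complex.norm_real, Real.norm_eq_abs,
        abs_of_pos hr0]
      nlinarith [norm_nonneg z])
    rw [dist_eq_norm, zero_add, ← hQ] at this
    exact this
  refine ⟨1 - Q, ?_, ?_, ?_⟩
  · obtain ⟨m, rfl⟩ : ∃ m, n = m + 1 := ⟨n - 1, by omega⟩
    simp [Q, eval_finsetSum, Finset.sum_range_succ']
  · have h1 := hapx 1 (by simp)
    have h2 : ‖(1 + -(r : ℂ) * 1) ^ (a : ℂ)‖ < η / 3 := by
      have : (1 + -(r : ℂ) * 1) = ((1 - r : ℝ) : ℂ) := by push_cast; ring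
      rw [this, ← Complex.ofReal_cpow (by linarith), Complex.norm_real, Real.norm_eq_abs,
        abs_of_nonneg (by apply Real.rpow_nonneg; linarith)]
      exact hra
    have h3 : ‖aeval (1 : ℂ) Q‖ = |Q.eval 1| := by
      have : aeval (1 : ℂ) Q = ((Q.eval 1 : ℝ) : ℂ) := by
        simpa using (aeval_algebraMap_apply ℂ (1 : ℝ) Q)
      rw [this, Complex.norm_real, Real.norm_eq_abs]
    have h4 := norm_sub_norm_le (aeval (1 : ℂ) Q) ((1 + -(r : ℂ) * 1) ^ (a : ℂ))
    rw [norm_sub_rev] at h4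
    rw [h3] at h4
    simp only [eval_sub, eval_one, sub_sub_cancel_left, abs_neg]
    linarith
  · intro z hz
    have h1 := hapx z hz
    have hu : ‖-(r : ℂ) * z‖ < 1 := by
      simp [abs_of_pos hr0]; nlinarith [norm_nonneg z]
    have h2 := (norm_cpow_add_norm_one_sub_cpow_le ha hu).trans_lt hab
    simp only [map_sub, map_one, sub_sub_cancel]
    set w := (1 + -(r : ℂ) * z) ^ (a : ℂ)
    set q := aeval z Q
    have h3 : ‖q‖ ≤ ‖w‖ + ‖w - q‖ := by
      simpa using norm_sub_le w (w - q)
    have h4 : ‖1 - q‖ ≤ ‖1 - w‖ + ‖w - q‖ := by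
      simpa using norm_add_le (1 - w) (w - q)
    linarith

open Polynomial in
/-- Polynomials mapping the unit disc into thin neighbourhoods of `[0, 1]`. -/
theorem exists_polynomial_norm_add_norm_one_sub_le (𝕜 : Type*) [RCLike 𝕜] {η : ℝ} (hη : 0 < η) :
    ∃ P : 𝕜[X], P.eval 0 = 0 ∧ ‖P.eval 1 - 1‖ < η ∧
      ∀ z : 𝕜, ‖z‖ ≤ 1 → ‖P.eval z‖ + ‖1 - P.eval z‖ ≤ 1 + η := by
  obtain ⟨P, h0, h1, h2⟩ := exists_polynomial_complex hη
  have hre : ∀ x : ℝ, (P.map (algebraMap ℝ 𝕜)).eval (x : 𝕜) = ((P.eval x : ℝ) : 𝕜) := fun x => by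
    have := eval_map_apply (p := P) (algebraMap ℝ 𝕜) x
    simpa using this
  refine ⟨P.map (algebraMap ℝ 𝕜), ?_, ?_, ?_⟩
  · simpa [h0] using hre 0
  · have := hre 1
    rw [RCLike.ofReal_one] at this
    have e : ((P.eval 1 : ℝ) : 𝕜) - 1 = ((P.eval 1 - 1 : ℝ) : 𝕜) := by simp
    rw [this, e, RCLike.norm_ofReal]
    exact h1
  · intro z hz
    obtain ⟨φ, hφ⟩ : ∃ φ : 𝕜 →ₐ[ℝ] ℂ, ∀ z, ‖φ z‖ = ‖z‖ := by
      refine ⟨{ toFun := fun z => ⟨RCLike.re z, RCLike.im z⟩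
                map_one' := by apply Complex.ext <;> simp
                map_mul' := fun z w => by apply Complex.ext <;> simp
                map_zero' := by apply Complex.ext <;> simp
                map_add' := fun z w => by apply Complex.ext <;> simp
                commutes' := fun x => by apply Complex.ext <;> simp }, fun z => ?_⟩
      rw [← sq_eq_sq₀ (norm_nonneg _) (norm_nonneg _), Complex.sq_norm, Complex.normSq_apply]
      exact (RCLike.norm_sq_eq_def (z := z)).symm
    have h := h2 (φ z) (by rwa [hφ])
    have e : aeval (φ z) P = φ ((P.map (algebraMap ℝ 𝕜)).eval z) := by
      rw [aeval_algHom_apply, eval_map_algebraMap]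
    rwa [e, ← map_one φ, ← map_sub, hφ, hφ] at h

/-! ### Peaking functions at points of the Shilov boundary -/

section Peaking

variable {𝕜 : Type*} [RCLike 𝕜] {K : Type*} [TopologicalSpace K] [CompactSpace K]

theorem Subalgebra.norm_le_iff_forall_apply {A : Subalgebra 𝕜 C(K, 𝕜)} {u : A} {M : ℝ}
    (hM : 0 ≤ M) : ‖u‖ ≤ M ↔ ∀ x, ‖(u : C(K, 𝕜)) x‖ ≤ M :=
  ContinuousMap.norm_le _ hM

/-- If the closed set `S` is not a boundary, some `p ∈ A` of norm one is small on `S`. -/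
theorem exists_peak_of_not_isBoundary [Nonempty K] {A : Subalgebra 𝕜 C(K, 𝕜)} {S : Set K}
    (hS : IsClosed S) (hSA : ¬ IsBoundary A S) {δ : ℝ} (hδ : 0 < δ) :
    ∃ p ∈ A, (∃ s, p s = 1) ∧ (∀ x, ‖p x‖ ≤ 1) ∧ ∀ x ∈ S, ‖p x‖ < δ := by
  simp only [IsBoundary, not_forall, not_exists, not_and] at hSA
  obtain ⟨f, hfA, hf⟩ := hSA
  have hlt : ∀ x ∈ S, ‖f x‖ < ‖f‖ := fun x hx => (f.norm_coe_le_norm x).lt_of_ne (hf x hx)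
  obtain ⟨s, -, hs⟩ := isCompact_univ.exists_isMaxOn univ_nonempty
    (map_continuous f).norm.continuousOn
  have hsf : ‖f s‖ = ‖f‖ := le_antisymm (f.norm_coe_le_norm s)
    ((ContinuousMap.norm_le _ (norm_nonneg _)).2 fun x => hs (mem_univ x))
  -- Here `f = 0`, so `S` must be empty and the constant `1` works.
  by_cases h0 : f s = 0
  · refine ⟨1, A.one_mem, ⟨s, rfl⟩, fun x => by simp, fun x hx => ?_⟩
    have := hlt x hx
    rw [← hsf, h0, norm_zero] at this
    exact absurd this (norm_nonneg _).not_gt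
  let q : C(K, 𝕜) := (f s)⁻¹ • f
  have hq : ∀ x, q x = (f s)⁻¹ * f x := fun x => rfl
  have hfs : 0 < ‖f s‖ := norm_pos_iff.2 h0
  have hq1 : ∀ x, ‖q x‖ ≤ 1 := fun x => by
    rw [hq, norm_mul, norm_inv, inv_mul_le_one₀ hfs, hsf]
    exact f.norm_coe_le_norm x
  obtain ⟨c, hc1, hc⟩ : ∃ c < 1, ∀ x ∈ S, ‖q x‖ ≤ c := by
    rcases S.eq_empty_or_nonempty with rfl | hne
    · exact ⟨0, zero_lt_one, by simp⟩
    · obtain ⟨x, hx, hmax⟩ := hS.isCompact.exists_isMaxOn hne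
        (map_continuous q).norm.continuousOn
      refine ⟨‖q x‖, ?_, fun y hy => hmax hy⟩
      rw [hq, norm_mul, norm_inv, inv_mul_lt_one₀ hfs, hsf]
      exact hlt x hx
  obtain ⟨n, hn⟩ := exists_pow_lt_of_lt_one hδ hc1
  refine ⟨q ^ n, A.pow_mem (A.smul_mem hfA _) n, ⟨s, ?_⟩, fun x => ?_, fun x hx => ?_⟩
  · rw [ContinuousMap.pow_apply, hq, inv_mul_cancel₀ h0, one_pow]
  · rw [ContinuousMap.pow_apply, norm_pow]
    exact pow_le_one₀ (norm_nonneg _) (hq1 x)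
  · rw [ContinuousMap.pow_apply, norm_pow]
    exact (pow_le_pow_left₀ (norm_nonneg _) (hc x hx) n).trans_lt hn

/-- Some `p ∈ A` of norm one peaks only inside a given neighbourhood of a point of the Shilov
boundary. -/
theorem exists_peak_of_mem_shilovBoundary {A : Subalgebra 𝕜 C(K, 𝕜)} {t : K}
    (ht : t ∈ shilovBoundary A) {U : Set K} (hU : IsOpen U) (htU : t ∈ U) {δ : ℝ} (hδ : 0 < δ) :
    ∃ p ∈ A, ∃ s ∈ U, p s = 1 ∧ (∀ x, ‖p x‖ ≤ 1) ∧ ∀ x ∉ U, ‖p x‖ < δ := by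
  have : Nonempty K := ⟨t⟩
  -- The minimum with `1` forces the peak point, where `p s = 1`, into `U`.
  obtain ⟨p, hp, ⟨s, hs⟩, hp1, hpU⟩ := exists_peak_of_not_isBoundary hU.isClosed_compl
    (fun h => ht Uᶜ ⟨hU.isClosed_compl, h⟩ htU) (lt_min hδ one_pos)
  refine ⟨p, hp, s, by_contra fun h => ?_, hs, hp1, fun x hx =>
    (hpU x hx).trans_le (min_le_left _ _)⟩
  have := (hpU s h).trans_le (min_le_right _ _)
  rw [hs, norm_one] at this
  exact this.false

open Polynomial in
/-- A Urysohn-type lemma: peaking functions with values close to `[0, 1]`. -/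
theorem exists_urysohn_of_mem_shilovBoundary {A : Subalgebra 𝕜 C(K, 𝕜)} {t : K}
    (ht : t ∈ shilovBoundary A) {U : Set K} (hU : IsOpen U) (htU : t ∈ U) {η : ℝ} (hη : 0 < η) :
    ∃ g ∈ A, ∃ s ∈ U, ‖g s - 1‖ < η ∧ (∀ x ∉ U, ‖g x‖ < η) ∧
      ∀ x, ‖g x‖ + ‖1 - g x‖ ≤ 1 + η := by
  obtain ⟨P, h0, h1, h2⟩ := exists_polynomial_norm_add_norm_one_sub_le 𝕜 hη
  have hc : Tendsto (fun z => ‖P.eval z‖) (𝓝 0) (𝓝 0) := by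
    have := P.continuous.norm.tendsto 0
    rwa [h0, norm_zero] at this
  obtain ⟨δ, hδ, hδP⟩ := Metric.eventually_nhds_iff.1 (hc.eventually_lt_const hη)
  obtain ⟨p, hp, s, hsU, hs, hp1, hpU⟩ := exists_peak_of_mem_shilovBoundary ht hU htU hδ
  have hev : ∀ x, aeval p P x = P.eval (p x) := fun x => by
    simp
  refine ⟨aeval p P, Algebra.adjoin_le (by simpa using hp)
    (aeval_mem_adjoin_singleton 𝕜 p), s, hsU, ?_, fun x hx => ?_, fun x => ?_⟩
  · rwa [hev, hs]
  · rw [hev]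
    exact hδP (by simpa using hpU x hx)
  · rw [hev]
    exact h2 _ (hp1 x)

/-- If `h` is a finite family with uniformly bounded `𝕜`-combinations, then `∑ ‖φ (h t)‖` is
bounded accordingly. -/
theorem sum_norm_apply_le {E : Type*} [NormedAddCommGroup E] [NormedSpace 𝕜 E] {ι : Type*}
    (T : Finset ι) (h : ι → E) {M : ℝ}
    (hM : ∀ c : ι → 𝕜, (∀ t, ‖c t‖ = 1) → ‖∑ t ∈ T, c t • h t‖ ≤ M) (φ : StrongDual 𝕜 E) :
    ∑ t ∈ T, ‖φ (h t)‖ ≤ ‖φ‖ * M := by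
  choose c hc1 hc using fun t => RCLike.exists_norm_eq_mul_self (φ (h t))
  have : ((∑ t ∈ T, ‖φ (h t)‖ : ℝ) : 𝕜) = φ (∑ t ∈ T, c t • h t) := by
    simp [map_sum, hc]
  calc ∑ t ∈ T, ‖φ (h t)‖ = ‖φ (∑ t ∈ T, c t • h t)‖ := by
        rw [← this, RCLike.norm_ofReal, abs_of_nonneg (Finset.sum_nonneg fun _ _ => norm_nonneg _)]
    _ ≤ ‖φ‖ * ‖∑ t ∈ T, c t • h t‖ := φ.le_opNorm _
    _ ≤ ‖φ‖ * M := by gcongr; exact hM c hc1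

end Peaking

/-! ### Weakly small perturbations -/

section Perturbation

variable {𝕜 : Type*} [RCLike 𝕜] {K : Type*} [TopologicalSpace K] [CompactSpace K]

theorem AccPt.infinite_inter_of_mem_nhds {X : Type*} [TopologicalSpace X] [T1Space X] {x : X}
    {S U : Set X} (hx : AccPt x (𝓟 S)) (hU : U ∈ 𝓝 x) : (U ∩ S).Infinite := by
  intro hfin
  have h1 : ((U ∩ S) \ {x})ᶜ ∈ 𝓝 x :=
    (hfin.subset sdiff_subset).isClosed.isOpen_compl.mem_nhds (by simp)
  obtain ⟨y, ⟨hy, hyU⟩, hyS, hne⟩ :=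
    ((accPt_iff_frequently.1 hx).and_eventually (inter_mem h1 hU)).exists.imp
      fun y h => (⟨h.2, h.1.2, h.1.1⟩ : y ∈ ((U ∩ S) \ {x})ᶜ ∩ U ∧ y ∈ S ∧ y ≠ x)
  exact hy ⟨⟨hyU, hyS⟩, hne⟩

/-- Each point lies in at most one `V t`, whose `g t` contributes at most `1 + η ≤ 2`; the other
tails add up to at most `η ≤ 1`. Hence `3 * 2`, a bound independent of `T.card`. -/
theorem norm_sum_smul_le_of_pairwiseDisjoint {A : Subalgebra 𝕜 C(K, 𝕜)} {T : Finset K}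
    {V : K → Set K} (hV : (T : Set K).PairwiseDisjoint V) {g : K → A} {η η' : ℝ} (hη : η ≤ 1)
    (hη' : 0 ≤ η') (hTη : T.card * η' ≤ η)
    (hgV : ∀ t ∈ T, ∀ x ∉ V t, ‖(g t : C(K, 𝕜)) x‖ ≤ η')
    (hg : ∀ t ∈ T, ∀ x, ‖(g t : C(K, 𝕜)) x‖ ≤ 1 + η) {u : A} (hu : ‖u‖ ≤ 2)
    (c : K → 𝕜) (hc : ∀ t, ‖c t‖ = 1) :
    ‖∑ t ∈ T, c t • (g t * u)‖ ≤ 6 := by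
  classical
  rw [Subalgebra.norm_le_iff_forall_apply (by norm_num)]
  intro x
  have hsum : ∑ t ∈ T, ‖(g t : C(K, 𝕜)) x‖ ≤ 3 := by
    by_cases hx : ∃ t₁ ∈ T, x ∈ V t₁
    · obtain ⟨t₁, ht₁, hx₁⟩ := hx
      have h : ∑ t ∈ T.erase t₁, ‖(g t : C(K, 𝕜)) x‖ ≤ ∑ t ∈ T.erase t₁, η' :=
        Finset.sum_le_sum fun t ht => hgV t (Finset.mem_of_mem_erase ht) x fun hxt =>
          (hV (Finset.mem_of_mem_erase ht) ht₁ (Finset.ne_of_mem_erase ht)).le_bot ⟨hxt, hx₁⟩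
      have h' : ∑ t ∈ T.erase t₁, η' ≤ ∑ t ∈ T, η' :=
        Finset.sum_le_sum_of_subset_of_nonneg (Finset.erase_subset _ _) fun _ _ _ => hη'
      rw [← Finset.add_sum_erase _ _ ht₁]
      have := hg t₁ ht₁ x
      rw [Finset.sum_const (s := T), nsmul_eq_mul] at h'
      linarith
    · push Not at hx
      have h : ∑ t ∈ T, ‖(g t : C(K, 𝕜)) x‖ ≤ ∑ t ∈ T, η' :=
        Finset.sum_le_sum fun t ht => hgV t ht x (hx t ht)
      rw [Finset.sum_const, nsmul_eq_mul] at h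
      linarith
  have hux : ‖(u : C(K, 𝕜)) x‖ ≤ 2 := ((u : C(K, 𝕜)).norm_coe_le_norm x).trans hu
  have e : ((∑ t ∈ T, c t • (g t * u) : A) : C(K, 𝕜)) x =
      ∑ t ∈ T, c t * ((g t : C(K, 𝕜)) x * (u : C(K, 𝕜)) x) := by
    simp
  rw [e]
  calc _ ≤ ∑ t ∈ T, ‖(g t : C(K, 𝕜)) x‖ * ‖(u : C(K, 𝕜)) x‖ :=
        norm_sum_le_of_le _ fun t _ => by rw [norm_mul, norm_mul, hc, one_mul]
    _ ≤ 3 * 2 := by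
        rw [← Finset.sum_mul]
        gcongr
    _ = 6 := by norm_num

/-- If `|f|` attains its norm `1` at a limit point of the Shilov boundary, then finitely many
elements of the unit ball can be perturbed by a weakly small amount so that they all nearly
agree with `-f` at a common point where `|f|` is nearly `1`. -/
theorem exists_weak_perturbation [T2Space K] {A : Subalgebra 𝕜 C(K, 𝕜)} {f : A} {t₀ : K}
    (ht₀ : AccPt t₀ (𝓟 (shilovBoundary A))) (hft₀ : ‖(f : C(K, 𝕜)) t₀‖ = 1)
    {ι κ : Type*} [Finite ι] [Finite κ] (x : ι → A) (hx : ∀ i, ‖x i‖ ≤ 1)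
    (Φ : κ → StrongDual 𝕜 A) {δ : ℝ} (hδ : 0 < δ) :
    ∃ (y : ι → A) (s : K), (∀ i, ‖y i‖ ≤ 1) ∧ (∀ k i, ‖Φ k (y i) - Φ k (x i)‖ < δ) ∧
      (∀ i, ‖(y i : C(K, 𝕜)) s + (f : C(K, 𝕜)) s‖ < δ) ∧ 1 - δ < ‖(f : C(K, 𝕜)) s‖ := by
  have := Fintype.ofFinite ι
  have := Fintype.ofFinite κ
  obtain ⟨η, hη, hη1, hηδ, hηΦ⟩ : ∃ η : ℝ, 0 < η ∧ η ≤ 1 ∧ 5 * η < δ ∧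
      ∀ k, ‖Φ k‖ * η < δ / 2 := by
    have h1 : ∀ᶠ η in 𝓝 (0 : ℝ), ∀ k, ‖Φ k‖ * η < δ / 2 := eventually_all.2 fun k =>
      (continuous_const.mul continuous_id).tendsto' _ _ (mul_zero _) |>.eventually_lt_const
        (half_pos hδ)
    have h2 : ∀ᶠ η in 𝓝 (0 : ℝ), 5 * η < δ :=
      (continuous_const.mul continuous_id).tendsto' _ _ (mul_zero _) |>.eventually_lt_const hδ
    obtain ⟨η, ⟨h1, h2⟩, h3⟩ := (((h1.and h2).filter_mono nhdsWithin_le_nhds).and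
      (Ioo_mem_nhdsGT (show (0 : ℝ) < 1 by norm_num))).exists
    exact ⟨η, h3.1, h3.2.le, h2, h1⟩
  -- `C` bounds the total effect of all bumps on all `Φ k`; with `N` bumps and `N * (δ / 2) > C`,
  -- one of them has effect below `δ / 2`.
  let C : ℝ := ∑ k, ∑ _i : ι, ‖Φ k‖ * 6
  obtain ⟨N, hN⟩ := exists_nat_gt (C / (δ / 2))
  let U₀ : Set K := {s | ‖(f : C(K, 𝕜)) s - (f : C(K, 𝕜)) t₀‖ < η}
  have hU₀o : IsOpen U₀ :=
    isOpen_lt ((map_continuous (f : C(K, 𝕜))).sub continuous_const).norm continuous_const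
  have ht₀U : t₀ ∈ U₀ := by simpa [U₀] using hη
  obtain ⟨T, hT, hTN⟩ :=
    (ht₀.infinite_inter_of_mem_nhds (hU₀o.mem_nhds ht₀U)).exists_subset_card_eq N
  obtain ⟨V, hV, hVd⟩ := T.finite_toSet.t2_separation
  obtain ⟨η', hη', hη'η, hNη'⟩ : ∃ η' : ℝ, 0 < η' ∧ η' ≤ η ∧ T.card * η' ≤ η := by
    refine ⟨η / (N + 1), by positivity, div_le_self hη.le (by simp), ?_⟩
    rw [hTN, mul_div_assoc', div_le_iff₀ (by positivity)]
    nlinarith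
  have hex : ∀ t : K, ∃ (g : A) (s : K), t ∈ T → s ∈ V t ∩ U₀ ∧ ‖(g : C(K, 𝕜)) s - 1‖ < η' ∧
      (∀ x ∉ V t ∩ U₀, ‖(g : C(K, 𝕜)) x‖ < η') ∧
      ∀ x, ‖(g : C(K, 𝕜)) x‖ + ‖1 - (g : C(K, 𝕜)) x‖ ≤ 1 + η' := by
    intro t
    by_cases ht : t ∈ T
    · obtain ⟨g, hg, s, hs, h⟩ := exists_urysohn_of_mem_shilovBoundary (hT ht).2
        ((hV t).2.inter hU₀o) ⟨(hV t).1, (hT ht).1⟩ hη'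
      exact ⟨⟨g, hg⟩, s, fun _ => ⟨hs, h⟩⟩
    · exact ⟨0, t, fun h => absurd h ht⟩
  choose g s hgs using hex
  -- Adding `g * u i` to `x i` gives `x i * (1 - g) - f t₀ * g`, which replaces `x i` by `-f t₀`
  -- where `g` is near `1`.
  let u : ι → A := fun i => -algebraMap 𝕜 A ((f : C(K, 𝕜)) t₀) - x i
  have hu : ∀ i, ‖u i‖ ≤ 2 := fun i => by
    refine (norm_sub_le _ _).trans ?_
    have : ‖-algebraMap 𝕜 A ((f : C(K, 𝕜)) t₀)‖ ≤ 1 := by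
      rw [norm_neg, Subalgebra.norm_le_iff_forall_apply zero_le_one]
      intro z
      exact hft₀.le
    linarith [hx i]
  have hsum : ∀ k i, ∑ t ∈ T, ‖Φ k (g t * u i)‖ ≤ ‖Φ k‖ * 6 := fun k i =>
    sum_norm_apply_le T _ (norm_sum_smul_le_of_pairwiseDisjoint hVd hη1 hη'.le hNη'
      (fun t ht z hz => ((hgs t ht).2.2.1 z fun h => hz h.1).le)
      (fun t ht z => by
        have := (hgs t ht).2.2.2 z
        have := norm_nonneg (1 - (g t : C(K, 𝕜)) z)
        linarith) (hu i)) (Φ k)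
  obtain ⟨t, htT, ht⟩ : ∃ t ∈ T, ∑ k, ∑ i, ‖Φ k (g t * u i)‖ < δ / 2 := by
    by_contra! hcon
    have h1 : ∑ t ∈ T, δ / 2 ≤ ∑ t ∈ T, ∑ k, ∑ i, ‖Φ k (g t * u i)‖ := Finset.sum_le_sum hcon
    have h2 : ∑ t ∈ T, ∑ k, ∑ i, ‖Φ k (g t * u i)‖ ≤ C := by
      rw [Finset.sum_comm]
      refine Finset.sum_le_sum fun k _ => ?_
      rw [Finset.sum_comm]
      exact Finset.sum_le_sum fun i _ => hsum k i
    rw [Finset.sum_const, nsmul_eq_mul, hTN] at h1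
    rw [div_lt_iff₀ (half_pos hδ)] at hN
    linarith
  have htki : ∀ k i, ‖Φ k (g t * u i)‖ < δ / 2 := fun k i =>
    ((Finset.single_le_sum (f := fun i => ‖Φ k (g t * u i)‖) (fun _ _ => norm_nonneg _)
      (Finset.mem_univ i)).trans
      (Finset.single_le_sum (f := fun k => ∑ i, ‖Φ k (g t * u i)‖)
        (fun _ _ => Finset.sum_nonneg fun _ _ => norm_nonneg _) (Finset.mem_univ k))).trans_lt ht
  obtain ⟨⟨-, hsU⟩, hg1, -, hg2⟩ := hgs t htT
  have hpos : (0 : ℝ) < 1 + η := by linarith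
  -- Dividing by `1 + η` brings the perturbed functions back into the unit ball.
  let r : 𝕜 := ((1 + η : ℝ) : 𝕜)
  have hr0 : r ≠ 0 := RCLike.ofReal_ne_zero.2 hpos.ne'
  have hrn : ‖r‖ = 1 + η := by rw [RCLike.norm_ofReal, abs_of_pos hpos]
  have hrinv : ‖r⁻¹‖ ≤ 1 := by
    rw [norm_inv, hrn]
    exact inv_le_one_of_one_le₀ (by linarith)
  have hr1 : ‖1 - r‖ = η := by
    have : 1 - r = ((-η : ℝ) : 𝕜) := by simp [r]
    rw [this, RCLike.norm_ofReal, abs_neg, abs_of_pos hη]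
  have hxz : ∀ i z, ‖(x i : C(K, 𝕜)) z‖ ≤ 1 := fun i z =>
    ((x i : C(K, 𝕜)).norm_coe_le_norm z).trans (hx i)
  have hy : ∀ i z, ((r⁻¹ • (x i + g t * u i) : A) : C(K, 𝕜)) z =
      r⁻¹ * ((x i : C(K, 𝕜)) z * (1 - (g t : C(K, 𝕜)) z) -
        (f : C(K, 𝕜)) t₀ * (g t : C(K, 𝕜)) z) := fun i z => by
    have hal : algebraMap 𝕜 C(K, 𝕜) ((f : C(K, 𝕜)) t₀) z = (f : C(K, 𝕜)) t₀ := rfl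
    simp only [u, Subalgebra.coe_smul, Subalgebra.coe_add, Subalgebra.coe_mul, Subalgebra.coe_sub,
      Subalgebra.coe_neg, ContinuousMap.smul_apply, ContinuousMap.add_apply,
      ContinuousMap.mul_apply, ContinuousMap.sub_apply, ContinuousMap.neg_apply, smul_eq_mul,
      Subalgebra.coe_algebraMap, hal]
    ring
  refine ⟨fun i => r⁻¹ • (x i + g t * u i), s t, fun i => ?_, fun k i => ?_, fun i => ?_, ?_⟩
  · rw [Subalgebra.norm_le_iff_forall_apply zero_le_one]
    intro z
    rw [hy, norm_mul, norm_inv, hrn, inv_mul_le_one₀ hpos]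
    refine (norm_sub_le _ _).trans ?_
    rw [norm_mul, norm_mul, hft₀, one_mul]
    have := mul_le_of_le_one_left (norm_nonneg (1 - (g t : C(K, 𝕜)) z)) (hxz i z)
    linarith [hg2 z]
  · have e : Φ k (r⁻¹ • (x i + g t * u i)) - Φ k (x i) =
        r⁻¹ * (Φ k (g t * u i) + (1 - r) * Φ k (x i)) := by
      rw [map_smul, map_add, smul_eq_mul]
      field_simp
      ring
    have h1 : ‖Φ k (x i)‖ ≤ ‖Φ k‖ := (Φ k).unit_le_opNorm _ (hx i)
    rw [e, norm_mul]
    refine (mul_le_of_le_one_left (norm_nonneg _) hrinv).trans_lt ((norm_add_le _ _).trans_lt ?_)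
    rw [norm_mul, hr1]
    nlinarith [htki k i, hηΦ k]
  · have hfs : ‖(f : C(K, 𝕜)) (s t) - (f : C(K, 𝕜)) t₀‖ < η := hsU
    -- The three errors come from `1 - g`, from `1 - r` and from moving `t₀` to `s t`; together they
    -- are below `4 * η`.
    have e : r⁻¹ * ((x i : C(K, 𝕜)) (s t) * (1 - (g t : C(K, 𝕜)) (s t)) -
        (f : C(K, 𝕜)) t₀ * (g t : C(K, 𝕜)) (s t)) + (f : C(K, 𝕜)) (s t) =
        r⁻¹ * (((x i : C(K, 𝕜)) (s t) + (f : C(K, 𝕜)) t₀) * (1 - (g t : C(K, 𝕜)) (s t)) -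
          (f : C(K, 𝕜)) t₀ * (1 - r)) + ((f : C(K, 𝕜)) (s t) - (f : C(K, 𝕜)) t₀) := by
      field_simp
      ring
    rw [hy, e]
    refine (norm_add_le _ _).trans_lt ?_
    rw [norm_mul]
    have h1 : ‖((x i : C(K, 𝕜)) (s t) + (f : C(K, 𝕜)) t₀) * (1 - (g t : C(K, 𝕜)) (s t)) -
          (f : C(K, 𝕜)) t₀ * (1 - r)‖ ≤ 2 * η' + η := by
      refine (norm_sub_le _ _).trans ?_
      rw [norm_mul, norm_mul, hft₀, hr1, one_mul, norm_sub_rev 1]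
      have h2 : ‖(x i : C(K, 𝕜)) (s t) + (f : C(K, 𝕜)) t₀‖ ≤ 2 :=
        (norm_add_le _ _).trans (by linarith [hxz i (s t)])
      gcongr
    have h2 := mul_le_of_le_one_left (norm_nonneg (((x i : C(K, 𝕜)) (s t) + (f : C(K, 𝕜)) t₀) *
      (1 - (g t : C(K, 𝕜)) (s t)) - (f : C(K, 𝕜)) t₀ * (1 - r))) hrinv
    linarith
  · have hfs : ‖(f : C(K, 𝕜)) (s t) - (f : C(K, 𝕜)) t₀‖ < η := hsU
    have := norm_sub_norm_le ((f : C(K, 𝕜)) t₀) ((f : C(K, 𝕜)) (s t))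
    rw [norm_sub_rev] at this
    linarith

end Perturbation

/-! ### Formal implications and weak neighbourhoods inside slices -/

section Implications

variable {𝕜 : Type*} [RCLike 𝕜] {E : Type*} [NormedAddCommGroup E] [NormedSpace 𝕜 E]

theorem hasSupDistTwo_of_forall_lt {x : E} {S : Set E} (hx : ‖x‖ = 1)
    (hS : ∀ y ∈ S, ‖y‖ ≤ 1) (h : ∀ δ > 0, ∃ y ∈ S, 2 - δ < ‖x - y‖) : HasSupDistTwo x S := by
  refine ⟨?_, fun b hb => le_of_forall_pos_lt_add fun δ hδ => ?_⟩
  · rintro _ ⟨y, hy, rfl⟩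
    linarith [norm_sub_le x y, hS y hy]
  · obtain ⟨y, hy, hlt⟩ := h δ hδ
    linarith [hb ⟨y, hy, rfl⟩]

theorem IsBallSlice.isBallCCS {S : Set E} (hS : IsBallSlice 𝕜 S) : IsBallCCS 𝕜 S := by
  refine ⟨1, fun _ => 1, fun _ => S, by simp, by simp, fun _ => hS, ?_⟩
  ext x
  simp only [mem_ofPred_eq, Finset.univ_unique, Finset.sum_singleton, RCLike.ofReal_one, one_smul]
  exact ⟨fun h => ⟨fun _ => x, fun _ => h, rfl⟩, fun ⟨y, hy, h⟩ => h ▸ hy _⟩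

theorem IsBallSlice.isBallWeaklyOpen {S : Set E} (hS : IsBallSlice 𝕜 S) :
    IsBallWeaklyOpen 𝕜 S := by
  obtain ⟨φ, ε, -, -, rfl⟩ := hS
  let c := sSup ((fun y => RCLike.re (φ y)) '' Metric.closedBall (0 : E) 1) - ε
  refine ⟨{x | c < RCLike.re (φ ((toWeakSpace 𝕜 E).symm x))}, ?_, rfl⟩
  exact isOpen_lt continuous_const
    (RCLike.continuous_re.comp (WeakBilin.eval_continuous (topDualPairing 𝕜 E).flip φ))

theorem IsCCSDaugavetPoint.isDaugavetPoint {x : E} (h : IsCCSDaugavetPoint 𝕜 x) :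
    IsDaugavetPoint 𝕜 x :=
  ⟨h.1, fun S hS => h.2 S hS.isBallCCS⟩

theorem IsCCSDaugavetPoint.isCCSDeltaPoint {x : E} (h : IsCCSDaugavetPoint 𝕜 x) :
    IsCCSDeltaPoint 𝕜 x :=
  ⟨h.1, fun C hC _ => h.2 C hC⟩

theorem IsCCSDeltaPoint.isDeltaPoint {x : E} (h : IsCCSDeltaPoint 𝕜 x) : IsDeltaPoint 𝕜 x :=
  ⟨h.1, fun S hS => h.2 S hS.isBallCCS⟩

theorem IsSuperDaugavetPoint.isSuperDeltaPoint {x : E} (h : IsSuperDaugavetPoint 𝕜 x) :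
    IsSuperDeltaPoint 𝕜 x :=
  ⟨h.1, fun W hW hx => h.2 W hW ⟨x, hx⟩⟩

theorem IsSuperDeltaPoint.isDeltaPoint {x : E} (h : IsSuperDeltaPoint 𝕜 x) : IsDeltaPoint 𝕜 x :=
  ⟨h.1, fun S hS => h.2 S hS.isBallWeaklyOpen⟩

theorem IsDaugavetPoint.isDeltaPoint {x : E} (h : IsDaugavetPoint 𝕜 x) : IsDeltaPoint 𝕜 x :=
  ⟨h.1, fun S hS _ => h.2 S hS⟩

theorem bddAbove_re_image_closedBall (φ : StrongDual 𝕜 E) :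
    BddAbove ((fun y => RCLike.re (φ y)) '' Metric.closedBall (0 : E) 1) := by
  refine ⟨‖φ‖, ?_⟩
  rintro _ ⟨y, hy, rfl⟩
  exact (RCLike.re_le_norm _).trans (φ.unit_le_opNorm _ (by simpa using hy))

/-- Any `x` in the slice will do, with `δ` its slack in the defining inequality. This is the form in
which weak perturbations stay in the slice. -/
theorem IsBallSlice.exists_forall_norm_sub_lt {S : Set E} (hS : IsBallSlice 𝕜 S) :
    ∃ (φ : StrongDual 𝕜 E) (x : E) (δ : ℝ), ‖x‖ ≤ 1 ∧ 0 < δ ∧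
      ∀ y, ‖y‖ ≤ 1 → ‖φ y - φ x‖ < δ → y ∈ S := by
  obtain ⟨φ, ε, -, hε, rfl⟩ := hS
  set c := sSup ((fun y => RCLike.re (φ y)) '' Metric.closedBall (0 : E) 1) with hc
  obtain ⟨_, ⟨x, hx, rfl⟩, hlt⟩ := exists_lt_of_lt_csSup
    (s := (fun y => RCLike.re (φ y)) '' Metric.closedBall (0 : E) 1)
    ⟨_, mem_image_of_mem _ (Metric.mem_closedBall_self zero_le_one)⟩ (sub_lt_self c hε)
  refine ⟨φ, x, RCLike.re (φ x) - (c - ε), by simpa using hx, sub_pos.2 hlt, fun y hy h => ?_⟩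
  refine ⟨by simpa using hy, ?_⟩
  have h1 : RCLike.re (φ x) - RCLike.re (φ y) ≤ ‖φ y - φ x‖ := by
    rw [← map_sub, norm_sub_rev]
    exact RCLike.re_le_norm _
  linarith

theorem IsBallWeaklyOpen.exists_finset_forall_norm_sub_lt {W : Set E} (hW : IsBallWeaklyOpen 𝕜 W)
    {x : E} (hx : x ∈ W) :
    ∃ (F : Finset (StrongDual 𝕜 E)) (δ : ℝ), 0 < δ ∧
      ∀ y, ‖y‖ ≤ 1 → (∀ φ ∈ F, ‖φ y - φ x‖ < δ) → y ∈ W := by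
  obtain ⟨V, hV, rfl⟩ := hW
  -- The weak topology is induced from the product topology by `x ↦ (φ x)_φ`, so a basic
  -- neighbourhood involves finitely many `φ`.
  obtain ⟨O, hO, hOV⟩ := isOpen_induced_iff.1 hV
  have hxO : (fun φ : StrongDual 𝕜 E => φ x) ∈ O := by
    have : toWeakSpace 𝕜 E x ∈ V := hx.2
    rw [← hOV] at this
    exact this
  obtain ⟨F, u, hu, hFu⟩ := isOpen_pi_iff.1 hO _ hxO
  have hev : ∀ᶠ δ in 𝓝[>] (0 : ℝ), ∀ φ ∈ F, Metric.ball (φ x) δ ⊆ u φ := by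
    refine (Finset.eventually_all F).2 fun φ hφ => ?_
    obtain ⟨ε, hε, hball⟩ := Metric.isOpen_iff.1 (hu φ hφ).1 _ (hu φ hφ).2
    filter_upwards [Ioo_mem_nhdsGT hε] with δ hδ
    exact (Metric.ball_subset_ball hδ.2.le).trans hball
  obtain ⟨δ, hδ, hδ0⟩ := (hev.and self_mem_nhdsWithin).exists
  refine ⟨F, δ, hδ0, fun y hy h => ⟨by simpa using hy, ?_⟩⟩
  change toWeakSpace 𝕜 E y ∈ V
  rw [← hOV]
  refine hFu fun φ hφ => hδ φ hφ ?_
  rw [Metric.mem_ball, dist_eq_norm]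
  exact h φ hφ

end Implications

/-! ### Limit points of the Shilov boundary give Daugavet points -/

section Daugavet

variable {𝕜 : Type*} [RCLike 𝕜] {K : Type*} [TopologicalSpace K] [CompactSpace K] [T2Space K]
  {A : Subalgebra 𝕜 C(K, 𝕜)} {f : A} {t₀ : K}

theorem isCCSDaugavetPoint_of_accPt (hf : ‖f‖ = 1) (ht₀ : AccPt t₀ (𝓟 (shilovBoundary A)))
    (hft₀ : ‖(f : C(K, 𝕜)) t₀‖ = 1) : IsCCSDaugavetPoint 𝕜 f := by
  refine ⟨hf, ?_⟩
  rintro _ ⟨n, c, S, hc, hc1, hS, rfl⟩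
  choose φ x δ hx hδ hmem using fun i => (hS i).exists_forall_norm_sub_lt
  have hcn : ∀ i, ‖((c i : ℝ) : 𝕜)‖ = c i := fun i => by
    rw [RCLike.norm_ofReal, abs_of_pos (hc i)]
  refine hasSupDistTwo_of_forall_lt hf ?_ fun ε hε => ?_
  · rintro _ ⟨y, hy, rfl⟩
    rw [← hc1]
    refine norm_sum_le_of_le _ fun i _ => ?_
    obtain ⟨ψ, ρ, -, -, hSi⟩ := hS i
    have hyi : ‖y i‖ ≤ 1 := by
      have := hy i
      rw [hSi] at this
      simpa using this.1
    rw [norm_smul, hcn]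
    exact mul_le_of_le_one_right (hc i).le hyi
  · have hev : ∀ᶠ ρ in 𝓝[>] (0 : ℝ), ∀ i, ρ ≤ δ i := eventually_all.2 fun i => by
      filter_upwards [Ioo_mem_nhdsGT (hδ i)] with ρ hρ using hρ.2.le
    -- The distance found below exceeds `2 (1 - ρ) - ρ`, whence `ε / 3`.
    obtain ⟨ρ, hρ, hρ0, hρε⟩ :=
      (hev.and (Ioo_mem_nhdsGT (show 0 < ε / 3 by linarith))).exists
    obtain ⟨y, s, hy, hφ, hys, hfs⟩ := exists_weak_perturbation ht₀ hft₀ x hx φ hρ0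
    refine ⟨_, ⟨y, fun i => hmem i _ (hy i) ((hφ i i).trans_le (hρ i)), rfl⟩, ?_⟩
    have h1 := (((f - ∑ i, ((c i : ℝ) : 𝕜) • y i : A) : C(K, 𝕜))).norm_coe_le_norm s
    have hc1' : ∑ i, ((c i : ℝ) : 𝕜) = 1 := by
      rw [← RCLike.ofReal_sum, hc1, RCLike.ofReal_one]
    have e : ((f - ∑ i, ((c i : ℝ) : 𝕜) • y i : A) : C(K, 𝕜)) s = 2 * (f : C(K, 𝕜)) s -
        ∑ i, ((c i : ℝ) : 𝕜) * ((y i : C(K, 𝕜)) s + (f : C(K, 𝕜)) s) := by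
      simp only [mul_add, Finset.sum_add_distrib, ← Finset.sum_mul, hc1',
        Subalgebra.coe_sub, AddSubmonoidClass.coe_finsetSum, Subalgebra.coe_smul,
        ContinuousMap.sub_apply, ContinuousMap.sum_apply, ContinuousMap.smul_apply, smul_eq_mul]
      ring
    have h2 : ‖∑ i, ((c i : ℝ) : 𝕜) * ((y i : C(K, 𝕜)) s + (f : C(K, 𝕜)) s)‖ ≤ ρ := by
      calc _ ≤ ∑ i, c i * ρ := norm_sum_le_of_le _ fun i _ => by
            rw [norm_mul, hcn]
            exact mul_le_mul_of_nonneg_left (hys i).le (hc i).le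
        _ = ρ := by rw [← Finset.sum_mul, hc1, one_mul]
    have h3 := norm_sub_norm_le (2 * (f : C(K, 𝕜)) s)
      (∑ i, ((c i : ℝ) : 𝕜) * ((y i : C(K, 𝕜)) s + (f : C(K, 𝕜)) s))
    rw [← e, norm_mul, RCLike.norm_ofNat] at h3
    have h4 := h3.trans h1
    change 2 - ε < ‖((f - ∑ i, ((c i : ℝ) : 𝕜) • y i : A) : C(K, 𝕜))‖
    linarith

theorem isSuperDaugavetPoint_of_accPt (hf : ‖f‖ = 1) (ht₀ : AccPt t₀ (𝓟 (shilovBoundary A)))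
    (hft₀ : ‖(f : C(K, 𝕜)) t₀‖ = 1) : IsSuperDaugavetPoint 𝕜 f := by
  refine ⟨hf, fun W hW ⟨x, hx⟩ => ?_⟩
  obtain ⟨F, δ, hδ, hF⟩ := hW.exists_finset_forall_norm_sub_lt hx
  have hball : ∀ y ∈ W, ‖y‖ ≤ 1 := by
    obtain ⟨V, -, rfl⟩ := hW
    exact fun y hy => by simpa using hy.1
  refine hasSupDistTwo_of_forall_lt hf hball fun ε hε => ?_
  obtain ⟨ρ, hρ0, hρ⟩ : ∃ ρ, 0 < ρ ∧ ρ < min δ (ε / 3) :=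
    exists_between (lt_min hδ (by linarith))
  rw [lt_min_iff] at hρ
  obtain ⟨y, s, hy, hφ, hys, hfs⟩ := exists_weak_perturbation ht₀ hft₀ (fun _ : Unit => x)
    (fun _ => hball x hx) (fun φ : F => (φ : StrongDual 𝕜 A)) hρ0
  refine ⟨y (), hF _ (hy ()) fun φ h => (hφ ⟨φ, h⟩ ()).trans hρ.1, ?_⟩
  have h1 : ‖(f : C(K, 𝕜)) s - (y () : C(K, 𝕜)) s‖ ≤ ‖f - y ()‖ :=
    ((f - y () : A) : C(K, 𝕜)).norm_coe_le_norm s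
  have e : (f : C(K, 𝕜)) s - (y () : C(K, 𝕜)) s =
      2 * (f : C(K, 𝕜)) s - ((y () : C(K, 𝕜)) s + (f : C(K, 𝕜)) s) := by ring
  have h3 := norm_sub_norm_le (2 * (f : C(K, 𝕜)) s) ((y () : C(K, 𝕜)) s + (f : C(K, 𝕜)) s)
  rw [← e, norm_mul, RCLike.norm_ofNat] at h3
  linarith [hys (), hρ.2]

end Daugavet

/-! ### The Shilov boundary is a boundary -/

section Shilov

variable {𝕜 : Type*} [RCLike 𝕜] {K : Type*} [TopologicalSpace K]
  {A : Subalgebra 𝕜 C(K, 𝕜)}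

theorem isOpen_setOf_forall_norm_lt (F : Finset A) :
    IsOpen {x | ∀ g ∈ F, ‖(g : C(K, 𝕜)) x‖ < 1} := by
  have : {x | ∀ g ∈ F, ‖(g : C(K, 𝕜)) x‖ < 1} = ⋂ g ∈ F, {x | ‖(g : C(K, 𝕜)) x‖ < 1} := by
    ext x; simp
  rw [this]
  exact isOpen_biInter_finset fun g _ =>
    isOpen_lt (map_continuous (g : C(K, 𝕜))).norm continuous_const

variable [CompactSpace K]

/-- For each `y ∈ S`, a separating function can be normalised to be `0` at `t` and `2` at `y`;
compactness of `S` leaves finitely many. The result is a basic neighbourhood of `t` missing `S`, as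
`IsBoundary.diff_of_disjoint` requires. -/
theorem exists_finset_separating (hA : A.SeparatesPoints) {S : Set K} (hS : IsClosed S) {t : K}
    (ht : t ∉ S) :
    ∃ F : Finset A, (∀ g ∈ F, ‖(g : C(K, 𝕜)) t‖ < 1) ∧
      ∀ y ∈ S, ∃ g ∈ F, 1 ≤ ‖(g : C(K, 𝕜)) y‖ := by
  classical
  refine hS.isCompact.induction_on (p := fun S => ∃ F : Finset A,
    (∀ g ∈ F, ‖(g : C(K, 𝕜)) t‖ < 1) ∧ ∀ y ∈ S, ∃ g ∈ F, 1 ≤ ‖(g : C(K, 𝕜)) y‖)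
    ⟨∅, by simp⟩ ?_ ?_ ?_
  · rintro S T hST ⟨F, hF, hFT⟩
    exact ⟨F, hF, fun y hy => hFT y (hST hy)⟩
  · rintro S T ⟨F, hF, hFS⟩ ⟨G, hG, hGT⟩
    refine ⟨F ∪ G, fun g hg => (Finset.mem_union.1 hg).elim (hF g) (hG g), ?_⟩
    rintro y (hy | hy)
    · obtain ⟨g, hg, h⟩ := hFS y hy
      exact ⟨g, Finset.mem_union_left _ hg, h⟩
    · obtain ⟨g, hg, h⟩ := hGT y hy
      exact ⟨g, Finset.mem_union_right _ hg, h⟩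
  · intro y hy
    obtain ⟨_, ⟨g, hg, rfl⟩, hgy⟩ := hA (x := y) (y := t) fun h => ht (h ▸ hy)
    let h : A := (2 / (g y - g t)) • (⟨g, hg⟩ - algebraMap 𝕜 A (g t))
    have hh : ∀ z, (h : C(K, 𝕜)) z = 2 / (g y - g t) * (g z - g t) := fun z => rfl
    have hy2 : 1 < ‖(h : C(K, 𝕜)) y‖ := by
      rw [hh, div_mul_cancel₀ _ (sub_ne_zero.2 hgy), RCLike.norm_ofNat]
      norm_num
    refine ⟨{z | 1 < ‖(h : C(K, 𝕜)) z‖}, mem_nhdsWithin_of_mem_nhds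
      ((isOpen_lt continuous_const (map_continuous (h : C(K, 𝕜))).norm).mem_nhds hy2), {h}, ?_,
      fun z hz => ⟨h, by simp, le_of_lt hz⟩⟩
    intro g hg
    rw [Finset.mem_singleton.1 hg, hh, sub_self, mul_zero, norm_zero]
    exact zero_lt_one

/-- A basic open set that misses one boundary can be removed from every closed boundary. -/
theorem IsBoundary.diff_of_disjoint [Nonempty K] {S S₀ : Set K} (hS : IsBoundary A S)
    (hSc : IsClosed S) (hS₀ : IsBoundary A S₀) (F : Finset A)
    (hF : ∀ y ∈ S₀, ∃ g ∈ F, 1 ≤ ‖(g : C(K, 𝕜)) y‖) :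
    IsBoundary A (S \ {x | ∀ g ∈ F, ‖(g : C(K, 𝕜)) x‖ < 1}) := by
  -- Otherwise some `p` of norm one is below `1 / M` on the rest of `S`, where `M` bounds every `g ∈
  -- F`. Then `|p * g| < 1` on all of `S`, although `‖p * g‖ ≥ 1` for a `g ∈ F` that is large where
  -- `p` attains its norm in `S₀`.
  by_contra hcon
  let M : ℝ := 1 + ∑ g ∈ F, ‖g‖
  have hM : 0 < M := add_pos_of_pos_of_nonneg one_pos (Finset.sum_nonneg fun _ _ => norm_nonneg _)
  obtain ⟨p, hp, ⟨s, hs⟩, hp1, hpS⟩ := exists_peak_of_not_isBoundary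
    (hSc.sdiff (isOpen_setOf_forall_norm_lt F)) hcon (inv_pos.2 hM)
  have hpn : ‖p‖ = 1 := le_antisymm ((ContinuousMap.norm_le _ zero_le_one).2 hp1) (by
    simpa [hs] using p.norm_coe_le_norm s)
  obtain ⟨t, htS, ht⟩ := hS₀ p hp
  obtain ⟨g, hg, hgt⟩ := hF t htS
  obtain ⟨x, hxS, hx⟩ := hS (p * g) (A.mul_mem hp g.2)
  have h1 : 1 ≤ ‖p * (g : C(K, 𝕜))‖ := by
    refine le_trans ?_ ((p * (g : C(K, 𝕜))).norm_coe_le_norm t)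
    rw [ContinuousMap.mul_apply, norm_mul, ht, hpn, one_mul]
    exact hgt
  rw [← hx, ContinuousMap.mul_apply, norm_mul] at h1
  refine h1.not_gt ?_
  by_cases hxU : ∀ g ∈ F, ‖(g : C(K, 𝕜)) x‖ < 1
  · exact (mul_le_of_le_one_left (norm_nonneg _) (hp1 x)).trans_lt (hxU g hg)
  · have h2 : ‖(g : C(K, 𝕜)) x‖ ≤ M := by
      have h3 : ‖(g : C(K, 𝕜)) x‖ ≤ ‖g‖ := (g : C(K, 𝕜)).norm_coe_le_norm x
      have h4 := Finset.single_le_sum (f := fun g : A => ‖g‖) (fun _ _ => norm_nonneg _) hg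
      simp only [M]
      linarith
    calc ‖p x‖ * ‖(g : C(K, 𝕜)) x‖ ≤ ‖p x‖ * M := by gcongr
      _ < M⁻¹ * M := by
        exact mul_lt_mul_of_pos_right (hpS x ⟨hxS, hxU⟩) hM
      _ = 1 := inv_mul_cancel₀ hM.ne'

/-- The Shilov boundary is a boundary. -/
theorem isBoundary_shilovBoundary [Nonempty K] (hA : A.SeparatesPoints) :
    IsBoundary A (shilovBoundary A) := by
  classical
  intro f hf
  by_contra! hcon
  have hloc : ∀ t ∈ {t | ‖f t‖ = ‖f‖}, ∃ F : Finset A, (∀ g ∈ F, ‖(g : C(K, 𝕜)) t‖ < 1) ∧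
      ∃ S, IsBoundary A S ∧ ∀ y ∈ S, ∃ g ∈ F, 1 ≤ ‖(g : C(K, 𝕜)) y‖ := by
    intro t ht
    have htΓ : t ∉ shilovBoundary A := fun h => hcon t h ht
    simp only [shilovBoundary, mem_sInter, not_forall] at htΓ
    obtain ⟨S, ⟨hSc, hS⟩, htS⟩ := htΓ
    obtain ⟨F, hF, hFS⟩ := exists_finset_separating hA hSc htS
    exact ⟨F, hF, S, hS, hFS⟩
  have hMc : IsCompact {t | ‖f t‖ = ‖f‖} :=
    (isClosed_eq (map_continuous f).norm continuous_const).isCompact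
  choose! F hF S hS hFS using hloc
  obtain ⟨T, hTM, hT⟩ := hMc.elim_nhds_subcover
    (fun t => {x | ∀ g ∈ F t, ‖(g : C(K, 𝕜)) x‖ < 1})
    fun t ht => (isOpen_setOf_forall_norm_lt (F t)).mem_nhds (hF t ht)
  have huniv : IsBoundary A univ := fun g _ => by
    obtain ⟨s, -, hs⟩ := isCompact_univ.exists_isMaxOn univ_nonempty
      (map_continuous g).norm.continuousOn
    exact ⟨s, mem_univ s, le_antisymm (g.norm_coe_le_norm s)
      ((ContinuousMap.norm_le _ (norm_nonneg _)).2 fun x => hs (mem_univ x))⟩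
  -- Starting from `univ`, the basic sets covering the maximum set of `|f|` are removed one by one;
  -- the boundary that remains misses that set, which is absurd.
  have key : ∀ T' : Finset K, (∀ t ∈ T', ‖f t‖ = ‖f‖) →
      ∃ B, IsClosed B ∧ IsBoundary A B ∧
        ∀ t ∈ T', Disjoint B {x | ∀ g ∈ F t, ‖(g : C(K, 𝕜)) x‖ < 1} := by
    intro T'
    induction T' using Finset.induction_on with
    | empty => exact fun _ => ⟨univ, isClosed_univ, huniv, by simp⟩
    | insert t T' _ ih =>
      intro h
      obtain ⟨B, hBc, hB, hBT⟩ := ih fun t ht => h t (Finset.mem_insert_of_mem ht)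
      have ht := h t (Finset.mem_insert_self t T')
      refine ⟨B \ {x | ∀ g ∈ F t, ‖(g : C(K, 𝕜)) x‖ < 1},
        hBc.sdiff (isOpen_setOf_forall_norm_lt _),
        hB.diff_of_disjoint hBc (hS t ht) (F t) (hFS t ht), fun u hu => ?_⟩
      rcases Finset.mem_insert.1 hu with rfl | hu
      · exact disjoint_sdiff_left
      · exact (hBT u hu).mono_left sdiff_subset
  obtain ⟨B, -, hB, hBT⟩ := key T hTM
  obtain ⟨x, hxB, hx⟩ := hB f hf
  obtain ⟨t, ht, hxt⟩ := mem_iUnion₂.1 (hT hx)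
  exact (hBT t ht).le_bot ⟨hxB, hxt⟩

end Shilov

/-! ### Delta points force a limit point -/

section Delta

variable {𝕜 : Type*} [RCLike 𝕜] {K : Type*} [TopologicalSpace K]
  {A : Subalgebra 𝕜 C(K, 𝕜)} {f : A}

/-- The average of the evaluations at the points of `T`, rotated so that it norms `f`. -/
noncomputable def averagedEvaluation (f : A) (T : Finset K) : A →ₗ[𝕜] 𝕜 where
  toFun y := (T.card : 𝕜)⁻¹ *
    ∑ t ∈ T, (starRingEnd 𝕜) ((f : C(K, 𝕜)) t) * (y : C(K, 𝕜)) t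
  map_add' x y := by simp [mul_add, Finset.sum_add_distrib]
  map_smul' c y := by
    simp only [Subalgebra.coe_smul, ContinuousMap.smul_apply, smul_eq_mul, RingHom.id_apply,
      Finset.mul_sum]
    exact Finset.sum_congr rfl fun t _ => by ring

theorem averagedEvaluation_self {T : Finset K} (hT : T.Nonempty)
    (h : ∀ t ∈ T, ‖(f : C(K, 𝕜)) t‖ = 1) : averagedEvaluation f T f = 1 := by
  have hpos : (T.card : 𝕜) ≠ 0 := by exact_mod_cast hT.card_pos.ne'
  change (T.card : 𝕜)⁻¹ * ∑ t ∈ T, _ = 1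
  rw [Finset.sum_congr rfl fun t ht => by
    rw [RCLike.conj_mul, h t ht, RCLike.ofReal_one, one_pow]]
  simp [hpos]

variable [CompactSpace K]

theorem norm_averagedEvaluation_le (hf : ‖f‖ = 1) {T : Finset K} (hT : T.Nonempty) (y : A) :
    ‖averagedEvaluation f T y‖ ≤ 1 * ‖y‖ := by
  have hpos : (0 : ℝ) < T.card := by exact_mod_cast hT.card_pos
  change ‖(T.card : 𝕜)⁻¹ * _‖ ≤ _
  rw [norm_mul, norm_inv, RCLike.norm_natCast, inv_mul_le_iff₀ hpos, one_mul, ← nsmul_eq_mul,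
    ← Finset.sum_const]
  refine norm_sum_le_of_le _ fun t _ => ?_
  rw [norm_mul, RCLike.norm_conj]
  exact (mul_le_of_le_one_left (norm_nonneg _)
    (((f : C(K, 𝕜)).norm_coe_le_norm t).trans hf.le)).trans ((y : C(K, 𝕜)).norm_coe_le_norm t)

/-- There is a slice containing `f` all of whose elements are at distance at most `√2` from `f`
on a given finite set where `|f| = 1`. -/
theorem exists_isBallSlice_norm_sub_le (hf : ‖f‖ = 1) {T : Finset K} (hT : T.Nonempty)
    (h : ∀ t ∈ T, ‖(f : C(K, 𝕜)) t‖ = 1) :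
    ∃ S : Set A, IsBallSlice 𝕜 S ∧ f ∈ S ∧ ∀ y ∈ S, ‖y‖ ≤ 1 ∧ ∀ t ∈ T,
      ‖(f : C(K, 𝕜)) t - (y : C(K, 𝕜)) t‖ ≤ √2 := by
  classical
  have hpos : (0 : ℝ) < T.card := by exact_mod_cast hT.card_pos
  let φ : StrongDual 𝕜 A :=
    (averagedEvaluation f T).mkContinuous 1 (norm_averagedEvaluation_le hf hT)
  have hφf : φ f = 1 := averagedEvaluation_self hT h
  have hφ1 : ‖φ‖ ≤ 1 := LinearMap.mkContinuous_norm_le _ zero_le_one _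
  have hφ : ‖φ‖ = 1 := le_antisymm hφ1 (by
    simpa [hφf] using φ.unit_le_opNorm f hf.le)
  have hfB : f ∈ Metric.closedBall (0 : A) 1 := mem_closedBall_zero_iff.2 hf.le
  have hsup : sSup ((fun y => RCLike.re (φ y)) '' Metric.closedBall (0 : A) 1) = 1 := by
    refine le_antisymm (csSup_le ⟨_, mem_image_of_mem _ hfB⟩ ?_)
      (le_csSup (bddAbove_re_image_closedBall φ) ⟨f, hfB, by simp [hφf]⟩)
    rintro _ ⟨y, hy, rfl⟩
    exact (RCLike.re_le_norm _).trans ((φ.unit_le_opNorm y (by simpa using hy)).trans hφ1)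
  -- With this width, `T.card` numbers `a u ≤ 1` have sum above `T.card - 1`, so each is positive;
  -- then `|f - y|² = 1 - 2 a + |y|² ≤ 2` on `T`.
  refine ⟨_, ⟨φ, (T.card : ℝ)⁻¹, hφ, inv_pos.2 hpos, rfl⟩, ⟨hfB, ?_⟩, ?_⟩
  · rw [hsup, hφf, RCLike.one_re]
    linarith [inv_pos.2 hpos]
  · rintro y ⟨hyB, hy⟩
    have hy1 : ‖y‖ ≤ 1 := mem_closedBall_zero_iff.1 hyB
    refine ⟨hy1, fun t ht => ?_⟩
    have hyt : ∀ u, ‖(y : C(K, 𝕜)) u‖ ≤ 1 := fun u =>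
      ((y : C(K, 𝕜)).norm_coe_le_norm u).trans hy1
    let a : K → ℝ := fun u => RCLike.re ((starRingEnd 𝕜) ((f : C(K, 𝕜)) u) * (y : C(K, 𝕜)) u)
    have ha : ∀ u ∈ T, a u ≤ 1 := fun u hu => by
      refine (RCLike.re_le_norm _).trans ?_
      rw [norm_mul, RCLike.norm_conj, h u hu, one_mul]
      exact hyt u
    have hφy : RCLike.re (φ y) = (T.card : ℝ)⁻¹ * ∑ u ∈ T, a u := by
      change RCLike.re ((T.card : 𝕜)⁻¹ *
        ∑ t ∈ T, (starRingEnd 𝕜) ((f : C(K, 𝕜)) t) * (y : C(K, 𝕜)) t) = _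
      have : (T.card : 𝕜)⁻¹ = (((T.card : ℝ)⁻¹ : ℝ) : 𝕜) := by simp
      rw [this, RCLike.re_ofReal_mul, map_sum]
    rw [hsup, hφy] at hy
    have hsum : (T.card : ℝ) - 1 < ∑ u ∈ T, a u := by
      have := mul_lt_mul_of_pos_left hy hpos
      rwa [mul_sub, mul_one, mul_inv_cancel₀ hpos.ne', mul_inv_cancel_left₀ hpos.ne'] at this
    have hat : 0 < a t := by
      have h1 : ∑ u ∈ T.erase t, a u ≤ ∑ u ∈ T.erase t, (1 : ℝ) :=
        Finset.sum_le_sum fun u hu => ha u (Finset.mem_of_mem_erase hu)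
      have h2 := Finset.add_sum_erase T a ht
      have h3 := Finset.add_sum_erase T (fun _ => (1 : ℝ)) ht
      have h4 : ∑ u ∈ T, (1 : ℝ) = T.card := by simp
      linarith
    refine Real.le_sqrt_of_sq_le ?_
    rw [@norm_sub_sq 𝕜, h t ht, RCLike.inner_apply']
    have := hyt t
    have h0 := norm_nonneg ((y : C(K, 𝕜)) t)
    change 1 ^ 2 - 2 * a t + _ ≤ _
    nlinarith

theorem IsDeltaPoint.exists_accPt [Nonempty K] (hA : A.SeparatesPoints) (h : IsDeltaPoint 𝕜 f) :
    ∃ t₀ : K, AccPt t₀ (𝓟 (shilovBoundary A)) ∧ ‖(f : C(K, 𝕜)) t₀‖ = 1 := by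
  obtain ⟨hf, hΔ⟩ := h
  by_contra! hcon
  have hΓ := isBoundary_shilovBoundary hA
  have hΓc : IsClosed (shilovBoundary A) := isClosed_sInter fun S hS => hS.1
  have hfx : ∀ x, ‖(f : C(K, 𝕜)) x‖ ≤ 1 := fun x =>
    ((f : C(K, 𝕜)).norm_coe_le_norm x).trans hf.le
  let H : Set K := shilovBoundary A ∩ {t | ‖(f : C(K, 𝕜)) t‖ = 1}
  have hHc : IsClosed H :=
    hΓc.inter (isClosed_eq (map_continuous (f : C(K, 𝕜))).norm continuous_const)
  -- An infinite `H` would accumulate at one of its own points, by compactness.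
  have hHfin : H.Finite := by
    by_contra hinf
    obtain ⟨t, ht, hacc⟩ :=
      Set.Infinite.exists_accPt_of_subset_isCompact hinf hHc.isCompact Subset.rfl
    exact hcon t (hacc.mono (principal_mono.2 inter_subset_left)) ht.2
  obtain ⟨t₁, ht₁, hft₁⟩ := hΓ f f.2
  have hT : hHfin.toFinset.Nonempty := ⟨t₁, hHfin.mem_toFinset.2 ⟨ht₁, hft₁.trans hf⟩⟩
  obtain ⟨c, hc1, hc⟩ : ∃ c < 1, ∀ x ∈ shilovBoundary A \ H, ‖(f : C(K, 𝕜)) x‖ ≤ c := by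
    -- A point of `H` in the closure would be a limit point of `Γ` with `|f| = 1`.
    have hcl : IsClosed (shilovBoundary A \ H) := by
      refine isClosed_of_closure_subset fun x hx => ?_
      refine ⟨closure_minimal sdiff_subset hΓc hx, fun hxH => hcon x ?_ hxH.2⟩
      rw [accPt_principal_iff_clusterPt, ← mem_closure_iff_clusterPt]
      have hsub : shilovBoundary A \ H ⊆ shilovBoundary A \ {x} := fun y hy =>
        ⟨hy.1, fun h => hy.2 (by rwa [mem_singleton_iff.1 h])⟩
      exact closure_mono hsub hx
    rcases (shilovBoundary A \ H).eq_empty_or_nonempty with he | hne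
    · exact ⟨0, zero_lt_one, by simp [he]⟩
    · obtain ⟨x, hx, hmax⟩ := hcl.isCompact.exists_isMaxOn hne
        (map_continuous (f : C(K, 𝕜))).norm.continuousOn
      exact ⟨‖(f : C(K, 𝕜)) x‖, (hfx x).lt_of_ne fun h => hx.2 ⟨hx.1, h⟩, fun y hy => hmax hy⟩
  obtain ⟨S, hS, hfS, hSy⟩ := exists_isBallSlice_norm_sub_le hf hT
    fun t ht => (hHfin.mem_toFinset.1 ht).2
  have hub : (2 : ℝ) ≤ max (√2) (c + 1) := by
    refine (hΔ S hS hfS).2 ?_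
    rintro _ ⟨y, hy, rfl⟩
    obtain ⟨x, hx, hxn⟩ := hΓ ((f - y : A) : C(K, 𝕜)) (f - y).2
    change ‖((f - y : A) : C(K, 𝕜))‖ ≤ _
    rw [← hxn]
    change ‖(f : C(K, 𝕜)) x - (y : C(K, 𝕜)) x‖ ≤ _
    by_cases hxH : x ∈ H
    · exact le_max_of_le_left ((hSy y hy).2 x (hHfin.mem_toFinset.2 hxH))
    · exact le_max_of_le_right ((norm_sub_le _ _).trans (add_le_add (hc x ⟨hx, hxH⟩)
        (((y : C(K, 𝕜)).norm_coe_le_norm x).trans (hSy y hy).1)))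
  refine hub.not_gt (max_lt ?_ (by linarith))
  rw [Real.sqrt_lt' two_pos]
  norm_num

end Delta

theorem mainTheorem6 {𝕜 : Type*} [RCLike 𝕜] {K : Type*} [TopologicalSpace K] [CompactSpace K]
    [T2Space K] (A : Subalgebra 𝕜 C(K, 𝕜)) (hA : IsUniformAlgebra A) (f : A) (hf : ‖f‖ = 1) :
    List.TFAE [
      ∃ t₀ : K, AccPt t₀ (𝓟 (shilovBoundary A)) ∧ ‖f‖ = ‖(f : C(K, 𝕜)) t₀‖,
      IsCCSDaugavetPoint 𝕜 f,
      IsCCSDeltaPoint 𝕜 f,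
      IsSuperDaugavetPoint 𝕜 f,
      IsSuperDeltaPoint 𝕜 f,
      IsDaugavetPoint 𝕜 f,
      IsDeltaPoint 𝕜 f] := by
  have : Nonempty K := by
    by_contra hK
    have := not_nonempty_iff.1 hK
    have h0 : ‖f‖ ≤ 0 := (Subalgebra.norm_le_iff_forall_apply le_rfl).2 isEmptyElim
    linarith
  tfae_have 1 → 2
  | ⟨_, ht₀, h⟩ => isCCSDaugavetPoint_of_accPt hf ht₀ (h.symm.trans hf)
  tfae_have 1 → 4
  | ⟨_, ht₀, h⟩ => isSuperDaugavetPoint_of_accPt hf ht₀ (h.symm.trans hf)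
  tfae_have 2 → 3 := IsCCSDaugavetPoint.isCCSDeltaPoint
  tfae_have 2 → 6 := IsCCSDaugavetPoint.isDaugavetPoint
  tfae_have 3 → 7 := IsCCSDeltaPoint.isDeltaPoint
  tfae_have 4 → 5 := IsSuperDaugavetPoint.isSuperDeltaPoint
  tfae_have 5 → 7 := IsSuperDeltaPoint.isDeltaPoint
  tfae_have 6 → 7 := IsDaugavetPoint.isDeltaPoint
  tfae_have 7 → 1 := fun h =>
    let ⟨t₀, ht₀, h1⟩ := h.exists_accPt hA.separatesPoints
    ⟨t₀, ht₀, hf.trans h1.symm⟩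
  tfae_finish
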